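/- **Theorem 5 (Generalized Bianchi identities).** Let $M$ be a paracompact (Hausdorff) finite-dimensional $C^\infty$ manifold and $\mathfrak X(M)$ its module of smooth vector fields. A vector $l$-form on $M$ is an alternating $C^\infty(M)$-multilinear map $\mathfrak X(M)^l\to\mathfrak X(M)$, and $[\cdot,\cdot]$ denotes the Frölicher–Nijenhuis bracket of vector forms. Let $L$ be a vector $1$-form of constant rank $n\ge 1$ with $\tfrac12[L,L]=0$ and $\operatorname{Im}(L_z)=\operatorname{Ker}(L_z)$ for all $z\in M$. Let $\Gamma$ be an $L$-connection, i.e. a vector $1$-form with $L\Gamma=L$ and $\Gamma L=-L$. Let $h=\tfrac12(I+\Gamma)$ be its horizontal projector, $T=\tfrac12[L,\Gamma]$ its torsion and $R=-\tfrac12[h,h]$ its curvature. Then (a) $[L,R]=[h,T]$; (b) $[h,R]=0$. Suppose moreover that $C$ is a canonical vector field of $L$: a smooth vector field such that around every point of $M$ there are coordinates $(x^1,\dots,x^n;y^1,\dots,y^n)$ with $L\frac{\partial}{\partial x^i}=\frac{\partial}{\partial y^i}$, $L\frac{\partial}{\partial y^i}=0$ and $C=\sum_i y^i\frac{\partial}{\partial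 y^i}$. Call a smooth vector field $S'$ with $LS'=C$ an $L$-semispray. Let $S=hS'$ be the canonical $L$-semispray of $\Gamma$, where $S'$ is an arbitrary $L$-semispray, and let $t=T^\circ-\tfrac12[C,\Gamma]$ be the strong torsion of $\Gamma$, where $T^\circ=i_{S'}T=T(S',\cdot)$ for an arbitrary $L$-semispray $S'$ ($S$ and $t$ do not depend on the choice of $S'$). Then identity (b) can be put in the form $$[[L,S],R]=-[t,R].$$ -/

import Mathlib

open scoped Manifold ContDiff

noncomputable section

namespace LConn

/-! ### Functions, vector fields and vector forms on a smooth manifold `M` modelled on `E` -/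

/-- The algebra `𝔉(M)` of smooth real functions. -/
abbrev Fun (E M : Type*) [NormedAddCommGroup E] [NormedSpace ℝ E]
    [TopologicalSpace M] [ChartedSpace E M] :=
  C^∞⟮𝓘(ℝ, E), M; ℝ⟯

/-- The smooth vector fields `𝔛(M)`: smooth sections of the tangent bundle. -/
abbrev VField (E M : Type*) [NormedAddCommGroup E] [NormedSpace ℝ E]
    [TopologicalSpace M] [ChartedSpace E M] [IsManifold 𝓘(ℝ, E) ∞ M] :=
  Cₛ^∞⟮𝓘(ℝ, E); E, (TangentSpace 𝓘(ℝ, E) : M → Type _)⟯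

section Basic

variable {E M : Type*} [NormedAddCommGroup E] [NormedSpace ℝ E]
  [TopologicalSpace M] [ChartedSpace E M] [IsManifold 𝓘(ℝ, E) ∞ M]

/-- Multiplication of a vector field by a smooth function. -/
instance : SMul (Fun E M) (VField E M) where
  smul f X := ⟨fun z => f z • X z, f.contMDiff.smul_section X.contMDiff⟩

theorem smul_apply (f : Fun E M) (X : VField E M) (z : M) : (f • X) z = f z • X z := rfl

instance : Module (Fun E M) (VField E M) where
  one_smul X := by ext z; simp [smul_apply]
  mul_smul f g X := by
    ext z
    exact mul_smul (f z) (g z) (X z)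
  smul_zero f := by ext z; simp [smul_apply]
  smul_add f X Y := by
    ext z
    exact smul_add (f z) (X z) (Y z)
  add_smul f g X := by
    ext z
    exact add_smul (f z) (g z) (X z)
  zero_smul X := by ext z; simp [smul_apply]

instance : IsScalarTower ℝ (Fun E M) (VField E M) where
  smul_assoc c f X := by
    ext z
    exact smul_assoc c (f z) (X z)

instance : SMulCommClass (Fun E M) ℝ (VField E M) where
  smul_comm f c X := by
    ext z
    exact smul_comm (f z) c (X z)

instance : SMulCommClass ℝ (Fun E M) (VField E M) where
  smul_comm c f X := by
    ext z
    exact smul_comm c (f z) (X z)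

/-- Evaluation `X ↦ X_z` of vector fields at a point. -/
def evalAt (z : M) : VField E M →ₗ[ℝ] TangentSpace 𝓘(ℝ, E) z where
  toFun X := X z
  map_add' _ _ := rfl
  map_smul' _ _ := rfl

variable (E M) in
/-- The `𝔉(M)`-module `Ψ¹(M)` of vector 1-forms, i.e. `𝔉(M)`-linear maps `𝔛(M) → 𝔛(M)`. -/
abbrev VForm1 := VField E M →ₗ[Fun E M] VField E M

variable (E M) in
/-- The `𝔉(M)`-module `Ψˡ(M)` of vector `l`-forms, i.e. alternating `𝔉(M)`-multilinear maps
`𝔛(M) × ⋯ × 𝔛(M) → 𝔛(M)`. -/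
abbrev VForm (l : ℕ) := VField E M [⋀^Fin l]→ₗ[Fun E M] VField E M

/-- The image `L_z(T_zM)` of a vector 1-form at `z`: the vectors `(LX)_z`, `X ∈ 𝔛(M)`. -/
def imageAt (L : VForm1 E M) (z : M) : Submodule ℝ (TangentSpace 𝓘(ℝ, E) z) :=
  LinearMap.range (evalAt z ∘ₗ L.restrictScalars ℝ)

/-- The kernel of `L_z : T_zM → T_zM`: the vectors `X_z`, where `X ∈ 𝔛(M)` has `(LX)_z = 0`. -/
def kerAt (L : VForm1 E M) (z : M) : Submodule ℝ (TangentSpace 𝓘(ℝ, E) z) :=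
  (LinearMap.ker (evalAt z ∘ₗ L.restrictScalars ℝ)).map (evalAt z)

theorem fin_two (i : Fin 2) : i = 0 ∨ i = 1 := by omega

theorem fin_three (i : Fin 3) : i = 0 ∨ i = 1 ∨ i = 2 := by omega

theorem fin_three_ne : (0 : Fin 3) ≠ 1 ∧ (0 : Fin 3) ≠ 2 ∧ (1 : Fin 3) ≠ 0 ∧ (1 : Fin 3) ≠ 2 ∧
    (2 : Fin 3) ≠ 0 ∧ (2 : Fin 3) ≠ 1 := by decide

theorem eq_zero_of_eq_neg {X : VField E M} (h : X = -X) : X = 0 := by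
  ext z
  have hz : X z = -X z := congrArg (fun Y : VField E M => Y z) h
  have h2 : (2 : ℝ) • X z = 0 := by
    rw [two_smul]
    nth_rewrite 1 [hz]
    exact neg_add_cancel _
  exact (smul_eq_zero.1 h2).resolve_left two_ne_zero

/-- Build a vector 2-form. -/
def VForm.mk₂ (f : VField E M → VField E M → VField E M)
    (add : ∀ X X' Y, f (X + X') Y = f X Y + f X' Y)
    (smul : ∀ (a : Fun E M) X Y, f (a • X) Y = a • f X Y)
    (anti : ∀ X Y, f X Y = -f Y X) : VForm E M 2 where
  toFun m := f (m 0) (m 1)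
  map_update_add' m i x y := by
    have add' : ∀ X Y Y', f X (Y + Y') = f X Y + f X Y' := fun X Y Y' => by
      rw [anti, add, anti X Y, anti X Y', neg_add]
    rcases fin_two i with rfl | rfl <;> simp [add, add']
  map_update_smul' m i a x := by
    have smul' : ∀ (a : Fun E M) X Y, f X (a • Y) = a • f X Y := fun a X Y => by
      rw [anti, smul, anti X Y, smul_neg]
    rcases fin_two i with rfl | rfl <;> simp [smul, smul']
  map_eq_zero_of_eq' m i j hm hij := by
    have alt : ∀ X, f X X = 0 := fun X => eq_zero_of_eq_neg (anti X X)
    change f (m 0) (m 1) = 0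
    rcases fin_two i with rfl | rfl <;> rcases fin_two j with rfl | rfl <;>
      first
      | exact (hij rfl).elim
      | (rw [hm]; exact alt _)

/-- Build a vector 3-form. -/
def VForm.mk₃ (f : VField E M → VField E M → VField E M → VField E M)
    (add : ∀ X X' Y Z, f (X + X') Y Z = f X Y Z + f X' Y Z)
    (smul : ∀ (a : Fun E M) X Y Z, f (a • X) Y Z = a • f X Y Z)
    (cyc : ∀ X Y Z, f X Y Z = f Y Z X)
    (anti : ∀ X Y Z, f X Y Z = -f X Z Y) : VForm E M 3 where
  toFun m := f (m 0) (m 1) (m 2)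
  map_update_add' m i x y := by
    have add₁ : ∀ X Y Y' Z, f X (Y + Y') Z = f X Y Z + f X Y' Z := fun X Y Y' Z => by
      rw [cyc, add, ← cyc X Y Z, ← cyc X Y' Z]
    have add₂ : ∀ X Y Z Z', f X Y (Z + Z') = f X Y Z + f X Y Z' := fun X Y Z Z' => by
      rw [cyc, add₁, ← cyc X Y Z, ← cyc X Y Z']
    obtain ⟨h01, h02, h10, h12, h20, h21⟩ := fin_three_ne
    rcases fin_three i with rfl | rfl | rfl <;>
      simp only [Function.update_self, Function.update_of_ne h01, Function.update_of_ne h02,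
        Function.update_of_ne h10, Function.update_of_ne h12, Function.update_of_ne h20,
        Function.update_of_ne h21, add, add₁, add₂]
  map_update_smul' m i a x := by
    have smul₁ : ∀ (a : Fun E M) X Y Z, f X (a • Y) Z = a • f X Y Z := fun a X Y Z => by
      rw [cyc, smul, ← cyc]
    have smul₂ : ∀ (a : Fun E M) X Y Z, f X Y (a • Z) = a • f X Y Z := fun a X Y Z => by
      rw [cyc, smul₁, ← cyc]
    obtain ⟨h01, h02, h10, h12, h20, h21⟩ := fin_three_ne
    rcases fin_three i with rfl | rfl | rfl <;>
      simp only [Function.update_self, Function.update_of_ne h01, Function.update_of_ne h02,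
        Function.update_of_ne h10, Function.update_of_ne h12, Function.update_of_ne h20,
        Function.update_of_ne h21, smul, smul₁, smul₂]
  map_eq_zero_of_eq' m i j hm hij := by
    have alt : ∀ X Y, f X Y Y = 0 := fun X Y => eq_zero_of_eq_neg (anti X Y Y)
    have alt₁ : ∀ X Y, f Y Y X = 0 := fun X Y => by rw [← cyc, alt]
    have alt₂ : ∀ X Y, f Y X Y = 0 := fun X Y => by rw [cyc, alt]
    change f (m 0) (m 1) (m 2) = 0
    rcases fin_three i with rfl | rfl | rfl <;> rcases fin_three j with rfl | rfl | rfl <;>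
      first
      | exact (hij rfl).elim
      | (rw [hm]; first | exact alt _ _ | exact alt₁ _ _ | exact alt₂ _ _)

@[simp] theorem VForm.mk₂_apply {f : VField E M → VField E M → VField E M} {add smul anti}
    (X Y : VField E M) : VForm.mk₂ f add smul anti ![X, Y] = f X Y := rfl

@[simp] theorem VForm.mk₃_apply {f : VField E M → VField E M → VField E M → VField E M}
    {add smul cyc anti} (X Y Z : VField E M) :
    VForm.mk₃ f add smul cyc anti ![X, Y, Z] = f X Y Z := rfl

theorem VForm.swap (A : VForm E M 2) (X Y : VField E M) : A ![X, Y] = -A ![Y, X] := by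
  have h := A.map_swap ![Y, X] (i := 0) (j := 1) (by decide)
  rw [← h]
  congr 1
  ext i
  fin_cases i <;> rfl

theorem VForm.add_left (A : VForm E M 2) (X X' Y : VField E M) :
    A ![X + X', Y] = A ![X, Y] + A ![X', Y] := A.map_vecCons_add ![Y] X X'

theorem VForm.smul_left (A : VForm E M 2) (a : Fun E M) (X Y : VField E M) :
    A ![a • X, Y] = a • A ![X, Y] := A.map_vecCons_smul ![Y] a X

theorem VForm.add_right (A : VForm E M 2) (X Y Y' : VField E M) :
    A ![X, Y + Y'] = A ![X, Y] + A ![X, Y'] := by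
  rw [A.swap, A.add_left, A.swap X Y, A.swap X Y', neg_add]

theorem VForm.smul_right (A : VForm E M 2) (a : Fun E M) (X Y : VField E M) :
    A ![X, a • Y] = a • A ![X, Y] := by
  rw [A.swap, A.smul_left, A.swap X Y, smul_neg]

/-- The interior product `i_S A = A(S, ·)` of a vector 2-form. -/
def iprod₂ (S : VField E M) (A : VForm E M 2) : VForm1 E M where
  toFun Y := A ![S, Y]
  map_add' := A.add_right S
  map_smul' a Y := A.smul_right a S Y

/-- The derivative `X·f` of a function along a vector field. -/
def dirDeriv (X : VField E M) (f : Fun E M) : Fun E M where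
  val z := mvfderiv 𝓘(ℝ, E) f z (X z)
  property := by
    have h := (f.contMDiff.contMDiff_tangentMap (m := ∞) (by simp)).comp X.contMDiff
    exact contMDiff_snd_tangentBundle_modelSpace ℝ 𝓘(ℝ, ℝ) |>.comp h

theorem dirDeriv_apply (X : VField E M) (f : Fun E M) (z : M) :
    dirDeriv X f z = mvfderiv 𝓘(ℝ, E) f z (X z) := rfl

end Basic

/-! ### The Lie bracket and the Frölicher–Nijenhuis bracket -/

section Bracket

variable {E M : Type*} [NormedAddCommGroup E] [NormedSpace ℝ E] [FiniteDimensional ℝ E]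
  [TopologicalSpace M] [ChartedSpace E M] [IsManifold 𝓘(ℝ, E) ∞ M]

/-- The Lie bracket `[X, Y]` of smooth vector fields. -/
instance : Bracket (VField E M) (VField E M) where
  bracket X Y := ⟨VectorField.mlieBracket 𝓘(ℝ, E) X Y, by
    have : CompleteSpace E := FiniteDimensional.complete ℝ E
    have : IsManifold 𝓘(ℝ, E) (minSmoothness ℝ 2) M := by
      rw [minSmoothness_of_isRCLikeNormedField]
      infer_instance
    have : IsManifold 𝓘(ℝ, E) ((⊤ : ℕ∞) + 1 : WithTop ℕ∞) M := by simpa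
    intro z
    exact ContMDiffAt.mlieBracket_vectorField (m := ⊤) (n := ⊤) (X.contMDiff z) (Y.contMDiff z)
      (by simp)⟩

theorem bracket_apply (X Y : VField E M) (z : M) :
    ⁅X, Y⁆ z = VectorField.mlieBracket 𝓘(ℝ, E) X Y z := rfl

theorem bracket_swap (X Y : VField E M) : ⁅X, Y⁆ = -⁅Y, X⁆ := by
  ext z
  exact VectorField.mlieBracket_swap_apply

theorem bracket_add_left (X X' Y : VField E M) : ⁅X + X', Y⁆ = ⁅X, Y⁆ + ⁅X', Y⁆ := by
  have : CompleteSpace E := FiniteDimensional.complete ℝ E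
  have : IsManifold 𝓘(ℝ, E) (minSmoothness ℝ 2) M := by
    rw [minSmoothness_of_isRCLikeNormedField]
    infer_instance
  ext z
  exact VectorField.mlieBracket_add_left X.mdifferentiableAt X'.mdifferentiableAt

theorem bracket_add_right (X Y Y' : VField E M) : ⁅X, Y + Y'⁆ = ⁅X, Y⁆ + ⁅X, Y'⁆ := by
  rw [bracket_swap, bracket_add_left, bracket_swap X Y, bracket_swap X Y', neg_add]

theorem bracket_smul_right (f : Fun E M) (X Y : VField E M) :
    ⁅X, f • Y⁆ = dirDeriv X f • Y + f • ⁅X, Y⁆ := by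
  have : CompleteSpace E := FiniteDimensional.complete ℝ E
  have : IsManifold 𝓘(ℝ, E) (minSmoothness ℝ 2) M := by
    rw [minSmoothness_of_isRCLikeNormedField]
    infer_instance
  ext z
  exact VectorField.mlieBracket_smul_right f.mdifferentiableAt Y.mdifferentiableAt

theorem bracket_smul_left (f : Fun E M) (X Y : VField E M) :
    ⁅f • X, Y⁆ = f • ⁅X, Y⁆ - dirDeriv Y f • X := by
  rw [bracket_swap, bracket_smul_right, bracket_swap X Y, smul_neg]
  abel

/-- The Frölicher–Nijenhuis bracket `[X, K]` of a vector field and a vector 1-form: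
`[X, K](Y) = [X, KY] - K[X, Y]`. -/
def fn01 (X : VField E M) (K : VForm1 E M) : VForm1 E M where
  toFun Y := ⁅X, K Y⁆ - K ⁅X, Y⁆
  map_add' Y Y' := by
    simp only [map_add, bracket_add_right]
    abel
  map_smul' f Y := by
    simp only [map_add, map_smul, bracket_smul_right, RingHom.id_apply, smul_sub]
    abel

/-- The Frölicher–Nijenhuis bracket `[K, X] = -[X, K]` of a vector 1-form and a vector field, so
`[K, X](Y) = [KY, X] - K[Y, X]`. -/
def fn10 (K : VForm1 E M) (X : VField E M) : VForm1 E M := -fn01 X K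

/-- The Frölicher–Nijenhuis bracket `[K, L]` of two vector 1-forms. -/
def fn11 (K L : VForm1 E M) : VForm E M 2 :=
  VForm.mk₂
    (fun X Y => ⁅K X, L Y⁆ + ⁅L X, K Y⁆ + K (L ⁅X, Y⁆) + L (K ⁅X, Y⁆)
      - K ⁅L X, Y⁆ - K ⁅X, L Y⁆ - L ⁅K X, Y⁆ - L ⁅X, K Y⁆)
    (fun X X' Y => by
      simp only [map_add, bracket_add_left]
      abel)
    (fun f X Y => by
      simp only [map_sub, map_smul, bracket_smul_left, smul_sub, smul_add]
      abel)
    (fun X Y => by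
      rw [bracket_swap (K X) (L Y), bracket_swap (L X) (K Y), bracket_swap X Y,
        bracket_swap (L X) Y, bracket_swap X (L Y), bracket_swap (K X) Y, bracket_swap X (K Y)]
      simp only [map_neg]
      abel)

/-- One of the three cyclic summands of `fn12`. -/
def fn12Aux (K : VForm1 E M) (A : VForm E M 2) (X Y Z : VField E M) : VField E M :=
  ⁅K X, A ![Y, Z]⁆ - A ![⁅K X, Y⁆, Z] - A ![Y, ⁅K X, Z⁆]
    - K ⁅X, A ![Y, Z]⁆ + K (A ![⁅X, Y⁆, Z]) + A ![K ⁅X, Y⁆, Z]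

/-- The Frölicher–Nijenhuis bracket `[K, A]` of a vector 1-form `K` and a vector 2-form `A`:
`[K, A](X, Y, Z)` is the cyclic sum over `X, Y, Z` of
`[KX, A(Y,Z)] - A([KX,Y], Z) - A(Y, [KX,Z]) - K[X, A(Y,Z)] + K A([X,Y], Z) + A(K[X,Y], Z)`. -/
def fn12 (K : VForm1 E M) (A : VForm E M 2) : VForm E M 3 :=
  VForm.mk₃ (fun X Y Z => fn12Aux K A X Y Z + fn12Aux K A Y Z X + fn12Aux K A Z X Y)
    (fun X X' Y Z => by
      simp only [fn12Aux, map_add, bracket_add_left, bracket_add_right, A.add_left, A.add_right]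
      abel)
    (fun f X Y Z => by
      have neg_left : ∀ U V, A ![-U, V] = -A ![U, V] := fun U V => by
        have := A.smul_left (-1) U V
        simpa using this
      have neg_right : ∀ U V, A ![U, -V] = -A ![U, V] := fun U V => by
        rw [A.swap, neg_left, A.swap U V]
      simp only [fn12Aux, map_add, map_smul, bracket_smul_left, bracket_smul_right,
        A.add_left, A.add_right, A.smul_left, A.smul_right, smul_add,
        sub_eq_add_neg, neg_left, neg_right, neg_add, map_neg, smul_neg]
      rw [A.swap Z X, A.swap (K X) Y]
      simp only [smul_neg, map_neg]
      abel)
    (fun X Y Z => by abel)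
    (fun X Y Z => by
      have neg_left : ∀ U V, A ![-U, V] = -A ![U, V] := fun U V => by
        have := A.smul_left (-1) U V
        simpa using this
      have neg_right : ∀ U V, A ![U, -V] = -A ![U, V] := fun U V => by
        rw [A.swap, neg_left, A.swap U V]
      have bneg : ∀ U V : VField E M, ⁅U, -V⁆ = -⁅U, V⁆ := fun U V => by
        have := bracket_add_right U V (-V)
        have h0 := bracket_add_right U 0 0
        simp only [add_neg_cancel] at this
        simp only [add_zero, left_eq_add] at h0
        rw [h0] at this
        exact (neg_eq_of_add_eq_zero_right this.symm).symm
      simp only [fn12Aux]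
      rw [A.swap Z Y, A.swap Y X, A.swap X Z, A.swap Y ⁅K X, Z⁆, A.swap Z ⁅K Y, X⁆,
        A.swap X ⁅K Z, Y⁆, A.swap Z ⁅K X, Y⁆, A.swap Y ⁅K Z, X⁆, A.swap X ⁅K Y, Z⁆,
        bracket_swap X Y, bracket_swap Y Z, bracket_swap Z X]
      simp only [bneg, neg_left, map_neg]
      abel)

/-! ### `L`-structures, `L`-connections -/

/-- The standing assumptions on `L`: a vector 1-form of constant rank `n ≥ 1`, with
`½[L, L] = 0` and `Im L_z = Ker L_z` at every point. -/
structure IsLStructure (n : ℕ) (L : VForm1 E M) : Prop where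
  pos : 1 ≤ n
  rank : ∀ z : M, Module.finrank ℝ (imageAt L z) = n
  nijenhuis : (1 / 2 : ℝ) • fn11 L L = 0
  image_eq_ker : ∀ z : M, imageAt L z = kerAt L z

/-- `C` is a canonical vector field of `L`: around each point there are smooth coordinates
`(x¹,…,xⁿ; y¹,…,yⁿ)` in which `L(∂/∂xⁱ) = ∂/∂yⁱ`, `L(∂/∂yⁱ) = 0` and `C = yⁱ ∂/∂yⁱ`.
The coordinate map is the chart `e` followed by the linear isomorphism `φ : E ≃ ℝⁿ × ℝⁿ`. -/
def IsCanonicalField (n : ℕ) (L : VForm1 E M) (C : VField E M) : Prop :=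
  ∀ z : M, ∃ e ∈ IsManifold.maximalAtlas 𝓘(ℝ, E) ∞ M, z ∈ e.source ∧
    ∃ φ : E ≃L[ℝ] (Fin n → ℝ) × (Fin n → ℝ), ∀ w ∈ e.source,
      (∀ X : VField E M, φ (mfderiv 𝓘(ℝ, E) 𝓘(ℝ, E) e w ((L X) w)) =
        (0, (φ (mfderiv 𝓘(ℝ, E) 𝓘(ℝ, E) e w (X w))).1)) ∧
      φ (mfderiv 𝓘(ℝ, E) 𝓘(ℝ, E) e w (C w)) = (0, (φ (e w)).2)

/-- `Γ` is an `L`-connection: `LΓ = L` and `ΓL = -L`. -/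
def IsLConnection (L Γ : VForm1 E M) : Prop :=
  L ∘ₗ Γ = L ∧ Γ ∘ₗ L = -L

/-- The horizontal projector `h = ½(I + Γ)`. -/
def horProj (Γ : VForm1 E M) : VForm1 E M := (1 / 2 : ℝ) • (LinearMap.id + Γ)

/-- The torsion `T = ½[L, Γ]`. -/
def torsion (L Γ : VForm1 E M) : VForm E M 2 := (1 / 2 : ℝ) • fn11 L Γ

/-- The curvature `R = -½[h, h]`. -/
def curvature (Γ : VForm1 E M) : VForm E M 2 :=
  -((1 / 2 : ℝ) • fn11 (horProj Γ) (horProj Γ))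

/-- `S` is an `L`-semispray: `LS = C`. -/
def IsSemispray (L : VForm1 E M) (C S : VField E M) : Prop := L S = C

/-- `S` is the canonical `L`-semispray of `Γ`: it is an `L`-semispray and `S = hS'` for some
(equivalently, every) `L`-semispray `S'`. -/
def IsCanonicalSemispray (L : VForm1 E M) (C : VField E M) (Γ : VForm1 E M)
    (S : VField E M) : Prop :=
  IsSemispray L C S ∧ ∃ S', IsSemispray L C S' ∧ S = horProj Γ S'

/-- The strong torsion `t = T° - ½[C, Γ]`, where the potential `T° = i_{S'}T` is formed with an
`L`-semispray `S'` (on which it does not depend). -/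
def strongTorsion (L : VForm1 E M) (C : VField E M) (Γ : VForm1 E M) (S' : VField E M) :
    VForm1 E M :=
  iprod₂ S' (torsion L Γ) - (1 / 2 : ℝ) • fn01 C Γ

end Bracket

end LConn

end

open LConn

/-! Both Bianchi identities are instances of the graded Jacobi identity. For vector 1-forms all
signs agree, and it says that the cyclic sum of `[K,[L,N]]` vanishes (`fn12_jacobi`). Taking all
three equal to `h` gives `3[h,[h,h]] = 0`. Taking `L, h, h` gives `[L,R] = [h,T]`, because `[L,I] =
0` turns `T` into `[L,h]`.

For the last form, `[I,R] = 0` reduces `[h,R] = 0` to `[Γ,R] = 0`, and it remains to decompose `Γ =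
[L,S] + t` (`fn10_add_strongTorsion`). This rests on two facts about vertical fields, those killed
by `L`: `Γ` acts on them as `-I`, and `L[S,U] = -U` for every vertical `U`. The second follows from
the vanishing Nijenhuis tensor of `L` and from `[C,L] = -L`, which is checked in coordinates
(`fn01_canonical`). Since `Im L_z = Ker L_z` is only a pointwise condition, facts about fields `LY`
pass to vertical fields by tensoriality. -/

namespace LConn

/-! ### Graded Jacobi identity in an abstract Lie ring -/

section LieRing

variable {V : Type*} [LieRing V]

/-- The Frölicher–Nijenhuis bracket of two additive endomorphisms of a Lie ring. -/
def fnPair (K L : V →+ V) (X Y : V) : V :=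
  ⁅K X, L Y⁆ + ⁅L X, K Y⁆ + K (L ⁅X, Y⁆) + L (K ⁅X, Y⁆)
    - K ⁅L X, Y⁆ - K ⁅X, L Y⁆ - L ⁅K X, Y⁆ - L ⁅X, K Y⁆

/-- One of the three cyclic summands of `fnTriple`. -/
def fnTripleAux (K : V →+ V) (A : V → V → V) (X Y Z : V) : V :=
  ⁅K X, A Y Z⁆ - A ⁅K X, Y⁆ Z - A Y ⁅K X, Z⁆
    - K ⁅X, A Y Z⁆ + K (A ⁅X, Y⁆ Z) + A (K ⁅X, Y⁆) Z

/-- The Frölicher–Nijenhuis bracket of an additive endomorphism of a Lie ring and a binary map. -/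
def fnTriple (K : V →+ V) (A : V → V → V) (X Y Z : V) : V :=
  fnTripleAux K A X Y Z + fnTripleAux K A Y Z X + fnTripleAux K A Z X Y

theorem lie_eq_neg_lie (X Y : V) : ⁅X, Y⁆ = -⁅Y, X⁆ := (lie_skew X Y).symm

/-- The Jacobi identity, oriented as a rewrite rule that eliminates double brackets with `Z`
outermost. -/
theorem lie_lie_rotate (X Y Z : V) : ⁅Z, ⁅X, Y⁆⁆ = ⁅Y, ⁅X, Z⁆⁆ - ⁅X, ⁅Y, Z⁆⁆ := by
  rw [leibniz_lie Z X Y, lie_eq_neg_lie Z Y, lie_neg, lie_eq_neg_lie ⁅Z, X⁆ Y, lie_eq_neg_lie Z X,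
    lie_neg, neg_neg, sub_eq_add_neg]

set_option maxHeartbeats 4000000 in
/-- The graded Jacobi identity of the Frölicher–Nijenhuis bracket for three endomorphisms of degree
one of a Lie ring. -/
theorem fnTriple_jacobi (K L M : V →+ V) (X Y Z : V) :
    fnTriple K (fnPair L M) X Y Z + fnTriple L (fnPair M K) X Y Z
      + fnTriple M (fnPair K L) X Y Z = 0 := by
  -- Normal form, whatever endomorphisms decorate the letters: `s*` put simple brackets in the order
  -- `X, Y, Z`, `o*` move the image of a bracket to the right slot, and `j*` remove an outermost
  -- `Z`. All terms then cancel in the additive group.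
  have s0 := fun P Q : V => fun (φ ψ : V →+ V) => lie_eq_neg_lie (φ P) (ψ Q)
  have s1 := fun P Q : V => fun (φ : V →+ V) => lie_eq_neg_lie (φ P) Q
  have s2 := fun P Q : V => fun (ψ : V →+ V) => lie_eq_neg_lie P (ψ Q)
  have o1 := fun (φ : V →+ V) (a b c : V) => lie_eq_neg_lie (φ ⁅a, b⁆) c
  have o2 := fun (φ ψ : V →+ V) (a b c : V) => lie_eq_neg_lie (φ (ψ ⁅a, b⁆)) c
  have j0 := lie_lie_rotate X Y Z
  have j1 := fun (φ : V →+ V) => lie_lie_rotate (φ X) Y Z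
  have j2 := fun (φ : V →+ V) => lie_lie_rotate X (φ Y) Z
  have j3 := fun (φ : V →+ V) => lie_lie_rotate X Y (φ Z)
  have j4 := fun (φ ψ : V →+ V) => lie_lie_rotate (φ X) (ψ Y) Z
  have j5 := fun (φ ψ : V →+ V) => lie_lie_rotate X (φ Y) (ψ Z)
  have j7 := fun (φ ψ χ : V →+ V) => lie_lie_rotate (φ X) (ψ Y) (χ Z)
  simp only [fnTriple, fnTripleAux, fnPair, lie_add, lie_sub, map_add, map_sub, map_neg, lie_neg,
    neg_lie, lie_lie, o1, o2, j0, j1, j2, j3, j4, j5, j7, s0 Y X, s0 Z X, s0 Z Y, s1 Y X, s1 Z X,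
    s1 Z Y, s2 Y X, s2 Z X, s2 Z Y, lie_eq_neg_lie Y X, lie_eq_neg_lie Z X, lie_eq_neg_lie Z Y]
  abel

end LieRing

/-! ### Bilinearity of the brackets and the two Bianchi identities -/

section Algebra

variable {E M : Type*} [NormedAddCommGroup E] [NormedSpace ℝ E]
  [TopologicalSpace M] [ChartedSpace E M] [IsManifold 𝓘(ℝ, E) ∞ M]

theorem VField.sum_apply {ι : Type*} (s : Finset ι) (X : ι → VField E M) (z : M) :
    (∑ i ∈ s, X i) z = ∑ i ∈ s, X i z := map_sum (evalAt z) X s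

theorem VForm.ext₂ {A B : VForm E M 2} (h : ∀ X Y, A ![X, Y] = B ![X, Y]) : A = B := by
  ext1 m
  have : m = ![m 0, m 1] := by ext1 i; fin_cases i <;> rfl
  rw [this, h]

theorem VForm.ext₃ {A B : VForm E M 3} (h : ∀ X Y Z, A ![X, Y, Z] = B ![X, Y, Z]) : A = B := by
  ext1 m
  have : m = ![m 0, m 1, m 2] := by ext1 i; fin_cases i <;> rfl
  rw [this, h]

theorem VForm.real_smul_left (A : VForm E M 2) (c : ℝ) (X Y : VField E M) :
    A ![c • X, Y] = c • A ![X, Y] := by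
  have h := A.smul_left (c • 1) X Y
  rwa [smul_assoc, one_smul, smul_assoc, one_smul] at h

theorem VForm.real_smul_right (A : VForm E M 2) (c : ℝ) (X Y : VField E M) :
    A ![X, c • Y] = c • A ![X, Y] := by
  rw [A.swap, A.real_smul_left, A.swap X Y, smul_neg]

theorem VForm1.map_real_smul (K : VForm1 E M) (c : ℝ) (X : VField E M) : K (c • X) = c • K X :=
  (K.restrictScalars ℝ).map_smul c X

theorem IsLConnection.left {L Γ : VForm1 E M} (hΓ : IsLConnection L Γ) (X : VField E M) : L (Γ X) = L X :=
  LinearMap.congr_fun hΓ.1 X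

theorem IsLConnection.right {L Γ : VForm1 E M} (hΓ : IsLConnection L Γ) (X : VField E M) : Γ (L X) = -L X :=
  LinearMap.congr_fun hΓ.2 X

variable [FiniteDimensional ℝ E]

/-- Smooth vector fields form a Lie ring. -/
noncomputable instance : LieRing (VField E M) where
  add_lie := bracket_add_left
  lie_add := bracket_add_right
  lie_self X := eq_zero_of_eq_neg (bracket_swap X X)
  leibniz_lie X Y Z := by
    have : CompleteSpace E := FiniteDimensional.complete ℝ E
    have : IsManifold 𝓘(ℝ, E) (minSmoothness ℝ 3) M := by
      rw [minSmoothness_of_isRCLikeNormedField]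
      exact IsManifold.of_le (n := ∞) ENat.LEInfty.out
    have h (U : VField E M) (z : M) := (U.contMDiff z).of_le (m := minSmoothness ℝ 2)
      (by rw [minSmoothness_of_isRCLikeNormedField]; exact ENat.LEInfty.out)
    ext z
    exact VectorField.leibniz_identity_mlieBracket_apply (h X z) (h Y z) (h Z z)

theorem bracket_real_smul_right (c : ℝ) (X Y : VField E M) : ⁅X, c • Y⁆ = c • ⁅X, Y⁆ := by
  have : CompleteSpace E := FiniteDimensional.complete ℝ E
  have : IsManifold 𝓘(ℝ, E) (minSmoothness ℝ 2) M := by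
    rw [minSmoothness_of_isRCLikeNormedField]
    infer_instance
  ext z
  exact VectorField.mlieBracket_const_smul_right Y.mdifferentiableAt

theorem bracket_real_smul_left (c : ℝ) (X Y : VField E M) : ⁅c • X, Y⁆ = c • ⁅X, Y⁆ := by
  rw [bracket_swap, bracket_real_smul_right, bracket_swap X Y, smul_neg]

theorem fn12_jacobi (K L N : VForm1 E M) :
    fn12 K (fn11 L N) + fn12 L (fn11 N K) + fn12 N (fn11 K L) = 0 :=
  VForm.ext₃ fun X Y Z =>
    fnTriple_jacobi K.toAddMonoidHom L.toAddMonoidHom N.toAddMonoidHom X Y Z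

theorem fn11_comm (K L : VForm1 E M) : fn11 K L = fn11 L K :=
  VForm.ext₂ fun X Y => by
    simp only [fn11, VForm.mk₂_apply]
    abel

theorem fn12_apply (K : VForm1 E M) (A : VForm E M 2) (X Y Z : VField E M) :
    fn12 K A ![X, Y, Z] = fn12Aux K A X Y Z + fn12Aux K A Y Z X + fn12Aux K A Z X Y := rfl

theorem fn11_apply (K L : VForm1 E M) (X Y : VField E M) :
    fn11 K L ![X, Y] = ⁅K X, L Y⁆ + ⁅L X, K Y⁆ + K (L ⁅X, Y⁆) + L (K ⁅X, Y⁆)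
      - K ⁅L X, Y⁆ - K ⁅X, L Y⁆ - L ⁅K X, Y⁆ - L ⁅X, K Y⁆ := rfl

theorem fn12_add_left (K L : VForm1 E M) (A : VForm E M 2) :
    fn12 (K + L) A = fn12 K A + fn12 L A :=
  VForm.ext₃ fun X Y Z => by
    simp only [fn12_apply, AlternatingMap.add_apply, fn12Aux, LinearMap.add_apply,
      bracket_add_left, A.add_left, A.add_right]
    abel

theorem fn12_smul_left (c : ℝ) (K : VForm1 E M) (A : VForm E M 2) :
    fn12 (c • K) A = c • fn12 K A :=
  VForm.ext₃ fun X Y Z => by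
    simp only [fn12_apply, AlternatingMap.smul_apply, fn12Aux, LinearMap.smul_apply,
      bracket_real_smul_left, A.real_smul_left, A.real_smul_right, smul_add, smul_sub]

theorem fn12_smul_right (c : ℝ) (K : VForm1 E M) (A : VForm E M 2) :
    fn12 K (c • A) = c • fn12 K A :=
  VForm.ext₃ fun X Y Z => by
    simp only [fn12_apply, AlternatingMap.smul_apply, fn12Aux,
      bracket_real_smul_right, VForm1.map_real_smul, smul_add, smul_sub]

theorem fn11_id (L : VForm1 E M) : fn11 L LinearMap.id = 0 :=
  VForm.ext₂ fun X Y => by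
    simp only [fn11_apply, LinearMap.id_apply, AlternatingMap.zero_apply]
    abel

theorem fn11_add_right (K L N : VForm1 E M) : fn11 K (L + N) = fn11 K L + fn11 K N :=
  VForm.ext₂ fun X Y => by
    simp only [fn11_apply, AlternatingMap.add_apply, LinearMap.add_apply,
      bracket_add_left, bracket_add_right, map_add]
    abel

theorem fn11_smul_right (c : ℝ) (K L : VForm1 E M) : fn11 K (c • L) = c • fn11 K L :=
  VForm.ext₂ fun X Y => by
    simp only [fn11_apply, AlternatingMap.smul_apply, LinearMap.smul_apply, bracket_real_smul_left,
      bracket_real_smul_right, VForm1.map_real_smul, smul_add, smul_sub]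

/-- For `K = I` each cyclic summand collapses to `A([X,Y],Z) - A([Z,X],Y)`, and these telescope. -/
theorem fn12_id (A : VForm E M 2) : fn12 LinearMap.id A = 0 :=
  VForm.ext₃ fun X Y Z => by
    simp only [fn12_apply, fn12Aux, LinearMap.id_apply, AlternatingMap.zero_apply]
    rw [A.swap Y ⁅X, Z⁆, A.swap Z ⁅Y, X⁆, A.swap X ⁅Z, Y⁆, bracket_swap X Z, bracket_swap Y X,
      bracket_swap Z Y]
    have neg_left : ∀ U V, A ![-U, V] = -A ![U, V] := fun U V => by
      simpa using A.real_smul_left (-1) U V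
    simp only [neg_left]
    abel

theorem torsion_eq_fn11_horProj (L Γ : VForm1 E M) : torsion L Γ = fn11 L (horProj Γ) := by
  rw [torsion, horProj, fn11_smul_right, fn11_add_right, fn11_id, zero_add]

theorem fn12_horProj_curvature (Γ : VForm1 E M) : fn12 (horProj Γ) (curvature Γ) = 0 := by
  have h := fn12_jacobi (horProj Γ) (horProj Γ) (horProj Γ)
  have h3 : (3 : ℝ) • fn12 (horProj Γ) (fn11 (horProj Γ) (horProj Γ)) = 0 := by
    rw [← h]; module
  rw [curvature, ← neg_smul, fn12_smul_right,
    (smul_eq_zero.1 h3).resolve_left (by norm_num), smul_zero]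

/-- Jacobi for `L, h, h`: its last two terms are both `[h,T]` by symmetry of the bracket, and its
first is `-2[L,R]`. -/
theorem fn12_curvature (L Γ : VForm1 E M) :
    fn12 L (curvature Γ) = fn12 (horProj Γ) (torsion L Γ) := by
  have h := fn12_jacobi L (horProj Γ) (horProj Γ)
  rw [fn11_comm (horProj Γ) L, ← torsion_eq_fn11_horProj L, add_assoc, add_eq_zero_iff_eq_neg] at h
  rw [curvature, ← neg_smul, fn12_smul_right, h]
  module

theorem fn01_apply (X : VField E M) (K : VForm1 E M) (Y : VField E M) :
    fn01 X K Y = ⁅X, K Y⁆ - K ⁅X, Y⁆ := rfl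

theorem fn10_apply (K : VForm1 E M) (X Y : VField E M) :
    fn10 K X Y = K ⁅X, Y⁆ - ⁅X, K Y⁆ := neg_sub _ _

/-- The field `Y` may depend on `z`; no global solution of `X = LY` is needed. -/
theorem IsLStructure.exists_eq_of_apply_eq_zero {n : ℕ} {L : VForm1 E M} (hL : IsLStructure n L) {X : VField E M}
    (hX : L X = 0) (z : M) : ∃ Y : VField E M, X z = L Y z := by
  have h : X z ∈ kerAt L z := ⟨X, by
    change L X z = 0
    rw [hX]; rfl, rfl⟩
  rw [← hL.image_eq_ker] at h
  obtain ⟨Y, hY⟩ := h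
  exact ⟨Y, hY.symm⟩

/-- Since `LS' = C`, both terms of `[C,Γ](Y)` cancel against terms of `[L,Γ](S',Y)`; `LΓ + ΓL = 0`
removes two more. -/
theorem two_smul_strongTorsion_apply {L Γ : VForm1 E M} {C S' : VField E M}
    (hΓ : IsLConnection L Γ) (hS : IsSemispray L C S') (Y : VField E M) :
    (2 : ℝ) • strongTorsion L C Γ S' Y
      = ⁅Γ S', L Y⁆ - L ⁅Γ S', Y⁆ - L ⁅S', Γ Y⁆ - Γ ⁅S', L Y⁆ := by
  have h : strongTorsion L C Γ S' Y
      = (1 / 2 : ℝ) • fn11 L Γ ![S', Y] - (1 / 2 : ℝ) • fn01 C Γ Y := rfl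
  rw [h, fn11_apply, fn01_apply, hΓ.left, hΓ.right, show L S' = C from hS]
  module

end Algebra

/-! ### Vector 1-forms act pointwise -/

section Tensoriality

variable {E M : Type*} [NormedAddCommGroup E] [NormedSpace ℝ E] [FiniteDimensional ℝ E]
  [TopologicalSpace M] [T2Space M] [ChartedSpace E M] [IsManifold 𝓘(ℝ, E) ∞ M]

/-- A vector 1-form acts pointwise. -/
theorem VForm1.apply_eq_zero_of_apply_eq_zero (K : VForm1 E M) {X : VField E M} {z : M}
    (hX : X z = 0) : K X z = 0 := by
  let t := trivializationAt E (TangentSpace 𝓘(ℝ, E) : M → Type _) z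
  let b := Module.Basis.ofVectorSpace ℝ E
  let ψ : SmoothBumpFunction 𝓘(ℝ, E) z := Classical.arbitrary _
  have hψ : tsupport ψ ⊆ t.baseSet := ψ.tsupport_subset_chartAt_source
  have hc (i) : ContMDiff 𝓘(ℝ, E) 𝓘(ℝ, ℝ) ∞
      fun w => ψ w • t.localFrameCoeff 𝓘(ℝ, E) b i w (X w) := by
    apply contMDiff_of_tsupport
    intro w hw
    have hw' : w ∈ t.baseSet := hψ (tsupport_smul_subset_left _ _ hw)
    exact ψ.contMDiff.contMDiffAt.smul
      (contMDiffAt_localFrameCoeff (e := t) b hw' (X.contMDiff w) i)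
  let f (i) : Fun E M := ⟨_, hc i⟩
  let e (i) : VField E M := ⟨fun w => ψ w • t.localFrame b i w,
    ContMDiffOn.smul_section_of_tsupport ψ.contMDiff.contMDiffOn t.open_baseSet hψ
      (t.contMDiffOn_localFrame_baseSet ∞ b i)⟩
  let g : Fun E M := ⟨ψ, ψ.contMDiff⟩
  -- One bump factor globalizes the coefficients of `X` and the other the local frame, hence the
  -- square of `g`.
  have hsum : g • g • X = ∑ i, f i • e i := by
    ext w
    simp only [smul_apply, VField.sum_apply]
    by_cases hw : w ∈ t.baseSet
    · change ψ w • ψ w • X w = ∑ i, (ψ w • t.localFrameCoeff 𝓘(ℝ, E) b i w (X w)) •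
        ψ w • t.localFrame b i w
      conv_lhs => rw [t.eq_sum_localFrameCoeff_smul (I := 𝓘(ℝ, E)) (b := b) hw (s := X)]
      simp only [Finset.smul_sum, smul_smul, smul_eq_mul]
      exact Finset.sum_congr rfl fun i _ => by congr 1; ring
    · have hw0 : ψ w = 0 := image_eq_zero_of_notMem_tsupport fun h => hw (hψ h)
      change ψ w • ψ w • X w = ∑ i, (ψ w • t.localFrameCoeff 𝓘(ℝ, E) b i w (X w)) •
        ψ w • t.localFrame b i w
      simp [hw0]
  have h := congrArg (fun Y : VField E M => Y z) (congrArg K hsum)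
  simp only [map_smul, map_sum, smul_apply, VField.sum_apply] at h
  have hf (i) : f i z = 0 := by
    change ψ z • t.localFrameCoeff 𝓘(ℝ, E) b i z (X z) = 0
    rw [hX, map_zero, smul_zero]
  have hg : g z = 1 := ψ.eq_one
  simpa [hf, hg] using h

end Tensoriality
end LConn

namespace LConn

/-! ### Vertical fields, semisprays and the decomposition of `Γ` -/

section Structure

variable {E M : Type*} [NormedAddCommGroup E] [NormedSpace ℝ E] [FiniteDimensional ℝ E]
  [TopologicalSpace M] [T2Space M] [ChartedSpace E M] [IsManifold 𝓘(ℝ, E) ∞ M]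

theorem VForm1.apply_eq_of_apply_eq (K : VForm1 E M) {X Y : VField E M} {z : M}
    (h : X z = Y z) : K X z = K Y z := by
  have h0 : K (X - Y) z = 0 := K.apply_eq_zero_of_apply_eq_zero (by
    rw [ContMDiffSection.coe_sub, Pi.sub_apply, h, sub_self])
  rw [map_sub, ContMDiffSection.coe_sub, Pi.sub_apply] at h0
  exact sub_eq_zero.1 h0

variable {n : ℕ} {L Γ : VForm1 E M}

/-- Membership in `kerAt` yields only some field with the value of `LX` at `z`; tensoriality lets it
replace `LX`. -/
theorem IsLStructure.apply_apply (hL : IsLStructure n L) (X : VField E M) : L (L X) = 0 := by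
  ext z
  have h : L X z ∈ imageAt L z := ⟨X, rfl⟩
  rw [hL.image_eq_ker] at h
  obtain ⟨Y, hY, hYX⟩ := h
  rw [← L.apply_eq_of_apply_eq (X := Y) (Y := L X) hYX]
  exact hY

/-- Two vector 1-forms that agree on the image of `L` agree on the kernel of `L`. -/
theorem IsLStructure.eq_of_apply_eq_zero (hL : IsLStructure n L) {K K' : VForm1 E M}
    (h : ∀ Y, K (L Y) = K' (L Y)) {X : VField E M} (hX : L X = 0) : K X = K' X := by
  ext z
  obtain ⟨Y, hY⟩ := hL.exists_eq_of_apply_eq_zero hX z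
  rw [K.apply_eq_of_apply_eq hY, K'.apply_eq_of_apply_eq hY, h]

theorem IsLConnection.apply_of_ker (hΓ : IsLConnection L Γ) (hL : IsLStructure n L)
    {X : VField E M} (hX : L X = 0) : Γ X = -X :=
  hL.eq_of_apply_eq_zero (K' := -LinearMap.id) hΓ.right hX

/-- `ΓX - X` is vertical because `LΓ = L`, so `Γ` negates it. -/
theorem IsLConnection.apply_apply (hΓ : IsLConnection L Γ) (hL : IsLStructure n L)
    (X : VField E M) : Γ (Γ X) = X := by
  have h := hΓ.apply_of_ker hL (X := Γ X - X) (by rw [map_sub, hΓ.left, sub_self])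
  rw [map_sub, neg_sub] at h
  exact sub_left_inj.1 h

theorem IsLStructure.nijenhuis_apply (hL : IsLStructure n L) (X Y : VField E M) :
    ⁅L X, L Y⁆ = L ⁅L X, Y⁆ + L ⁅X, L Y⁆ := by
  have h0 : fn11 L L = 0 := (smul_eq_zero.1 hL.nijenhuis).resolve_left (by norm_num)
  have h : (2 : ℝ) • (⁅L X, L Y⁆ - (L ⁅L X, Y⁆ + L ⁅X, L Y⁆)) = fn11 L L ![X, Y] := by
    rw [fn11_apply, hL.apply_apply]
    module
  rw [h0, AlternatingMap.zero_apply] at h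
  exact sub_eq_zero.1 ((smul_eq_zero.1 h).resolve_left two_ne_zero)

theorem IsLStructure.apply_bracket_left (hL : IsLStructure n L) {V : VField E M} (hV : L V = 0)
    (Y : VField E M) : L ⁅V, L Y⁆ = 0 := by
  have h := hL.nijenhuis_apply V Y
  rw [hV, zero_lie, zero_lie, map_zero, zero_add] at h
  exact h.symm

/-- The kernel distribution of `L` is involutive. -/
theorem IsLStructure.apply_bracket_ker (hL : IsLStructure n L) {V W : VField E M} (hV : L V = 0)
    (hW : L W = 0) : L ⁅V, W⁆ = 0 := by
  -- For vertical `V` the 1-form `[L,V]` is tensorial in `W`, so it suffices to test it on fields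
  -- `LY`.
  have h : fn10 L V W = (0 : VForm1 E M) W := hL.eq_of_apply_eq_zero (fun Y => by
    rw [fn10_apply, hL.apply_apply, lie_zero, sub_zero, hL.apply_bracket_left hV]; rfl) hW
  rwa [fn10_apply, hW, lie_zero, sub_zero] at h

variable {C S S' : VField E M}

/-- The Nijenhuis identity at `(S,Y)` with `LS = C` reads `[C,L](Y) = L[S,LY]`. -/
theorem IsSemispray.apply_bracket (hL : IsLStructure n L) (hC : fn01 C L = -L)
    (hS : IsSemispray L C S) (Y : VField E M) : L ⁅S, L Y⁆ = -L Y := by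
  have h := hL.nijenhuis_apply S Y
  rw [show L S = C from hS, ← sub_eq_iff_eq_add', ← fn01_apply, hC] at h
  exact h.symm

theorem IsSemispray.apply_bracket_ker (hL : IsLStructure n L) (hC : fn01 C L = -L)
    (hS : IsSemispray L C S) {U : VField E M} (hU : L U = 0) : L ⁅S, U⁆ = -U := by
  have h : fn10 L S U = (-LinearMap.id : VForm1 E M) U := hL.eq_of_apply_eq_zero (fun Y => by
    rw [fn10_apply, hL.apply_apply, lie_zero, sub_zero, hS.apply_bracket hL hC]; rfl) hU
  rwa [fn10_apply, hU, lie_zero, sub_zero] at h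

/-- The difference `V` of two semisprays is vertical. Its contributions cancel in pairs: `Γ` negates
the vertical fields `V` and `[V,LY]`, while involutivity gives `L[V,Y] = L[V,ΓY]`. -/
theorem strongTorsion_eq (hL : IsLStructure n L) (hΓ : IsLConnection L Γ)
    (hS : IsSemispray L C S) (hS' : IsSemispray L C S') :
    strongTorsion L C Γ S' = strongTorsion L C Γ S := by
  ext1 Y
  have hV : L (S' - S) = 0 := by
    rw [map_sub, show L S' = C from hS', show L S = C from hS, sub_self]
  have hY : L (Y - Γ Y) = 0 := by rw [map_sub, hΓ.left, sub_self]
  have hb := hΓ.apply_of_ker hL (hL.apply_bracket_left hV Y)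
  have hi := hL.apply_bracket_ker hV hY
  obtain ⟨V, rfl⟩ : ∃ V, S' = S + V := ⟨S' - S, by abel⟩
  rw [add_sub_cancel_left] at hV hb hi
  rw [lie_sub, map_sub] at hi
  refine smul_right_injective _ (two_ne_zero (α := ℝ)) ?_
  simp only [two_smul_strongTorsion_apply hΓ hS, two_smul_strongTorsion_apply hΓ hS',
    map_add, hΓ.apply_of_ker hL hV, add_lie, neg_lie, map_neg, hb, sub_eq_zero.1 hi]
  abel

theorem IsCanonicalSemispray.apply_eq (hL : IsLStructure n L) (hΓ : IsLConnection L Γ)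
    (hS : IsCanonicalSemispray L C Γ S) : Γ S = S := by
  obtain ⟨-, S', -, rfl⟩ := hS
  have h : horProj Γ S' = (1 / 2 : ℝ) • (S' + Γ S') := rfl
  rw [h, VForm1.map_real_smul, map_add, hΓ.apply_apply hL, add_comm]

/-- The decomposition of an `L`-connection into its canonical semispray and strong torsion. -/
theorem fn10_add_strongTorsion (hL : IsLStructure n L) (hΓ : IsLConnection L Γ)
    (hC : fn01 C L = -L) (hS : IsCanonicalSemispray L C Γ S) (hS' : IsSemispray L C S') :
    fn10 L S + strongTorsion L C Γ S' = Γ := by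
  -- Forming `t` with `S` itself allows the use of `ΓS = S`.
  rw [strongTorsion_eq hL hΓ hS.1 hS']
  ext1 Y
  refine smul_right_injective _ (two_ne_zero (α := ℝ)) ?_
  -- Twice the left side is `L[S,Y-ΓY] - ([S,LY] + Γ[S,LY])`. By `h1` and `h2`, which concern the
  -- vertical fields `Y-ΓY` and `[S,LY]+Y`, this is `-(Y-ΓY) + (Y+ΓY) = 2ΓY`.
  have h1 : L ⁅S, Y - Γ Y⁆ = -(Y - Γ Y) := hS.1.apply_bracket_ker hL hC (by
    rw [map_sub, hΓ.left, sub_self])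
  have h2 : Γ (⁅S, L Y⁆ + Y) = -(⁅S, L Y⁆ + Y) := hΓ.apply_of_ker hL (by
    rw [map_add, hS.1.apply_bracket hL hC, neg_add_cancel])
  rw [lie_sub, map_sub, sub_eq_iff_eq_add] at h1
  rw [map_add, ← eq_sub_iff_add_eq] at h2
  simp only [LinearMap.add_apply, smul_add, two_smul_strongTorsion_apply hΓ hS.1, fn10_apply,
    hS.apply_eq hL hΓ, h1, h2]
  module

theorem fn12_fn10_curvature (hL : IsLStructure n L) (hΓ : IsLConnection L Γ)
    (hC : fn01 C L = -L) (hS : IsCanonicalSemispray L C Γ S) (hS' : IsSemispray L C S') :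
    fn12 (fn10 L S) (curvature Γ) = -fn12 (strongTorsion L C Γ S') (curvature Γ) := by
  have h := fn12_horProj_curvature Γ
  rw [horProj, fn12_smul_left, fn12_add_left, fn12_id, zero_add] at h
  replace h := (smul_eq_zero.1 h).resolve_left (by norm_num)
  -- Only the outer `Γ` is decomposed; the one inside the curvature stays.
  nth_rw 1 [← fn10_add_strongTorsion hL hΓ hC hS hS', fn12_add_left] at h
  exact eq_neg_of_add_eq_zero_left h

end Structure
end LConn

namespace LConn

/-! ### The identity `[C,L] = -L` in adapted coordinates -/

section Coordinates

open VectorField Filter Topology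

/-- If `A ∘ B = B` and `B ∘ A = 0`, then the linear vector field `A` satisfies
`[A, B ∘ Y] - B [A, Y] = -B Y`. -/
theorem lieBracket_clm_comp {E : Type*} [NormedAddCommGroup E] [NormedSpace ℝ E] {A B : E →L[ℝ] E}
    (hAB : ∀ v, A (B v) = B v) (hBA : ∀ v, B (A v) = 0) {Y : E → E} {p : E}
    (hY : DifferentiableAt ℝ Y p) :
    lieBracket ℝ A (fun q => B (Y q)) p - B (lieBracket ℝ A Y p) = -B (Y p) := by
  have h : fderiv ℝ (fun q => B (Y q)) p = B.comp (fderiv ℝ Y p) :=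
    (B.hasFDerivAt.comp p hY.hasFDerivAt).fderiv
  simp only [lieBracket, h, A.fderiv, map_sub, hAB, hBA, ContinuousLinearMap.comp_apply]
  abel

variable {E M : Type*} [NormedAddCommGroup E] [NormedSpace ℝ E]
  [TopologicalSpace M] [ChartedSpace E M]

variable {e : OpenPartialHomeomorph M E}

theorem mdifferentiable_of_mem_maximalAtlas (he : e ∈ IsManifold.maximalAtlas 𝓘(ℝ, E) ∞ M) :
    e.MDifferentiable 𝓘(ℝ, E) 𝓘(ℝ, E) :=
  ⟨(contMDiffOn_of_mem_maximalAtlas he).mdifferentiableOn (by simp),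
    (contMDiffOn_symm_of_mem_maximalAtlas he).mdifferentiableOn (by simp)⟩

theorem isInvertible_mfderiv_symm (he : e ∈ IsManifold.maximalAtlas 𝓘(ℝ, E) ∞ M) {q : E}
    (hq : q ∈ e.target) : (mfderiv 𝓘(ℝ, E) 𝓘(ℝ, E) e.symm q).IsInvertible :=
  ⟨(mdifferentiable_of_mem_maximalAtlas he).symm.mfderiv hq, rfl⟩

variable [IsManifold 𝓘(ℝ, E) ∞ M]

/-- The pullback of a vector field along the inverse of a chart is its coordinate expression. -/
theorem mpullback_symm_apply (he : e ∈ IsManifold.maximalAtlas 𝓘(ℝ, E) ∞ M) (X : VField E M)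
    {q : E} (hq : q ∈ e.target) :
    mpullback 𝓘(ℝ, E) 𝓘(ℝ, E) e.symm X q
      = mfderiv 𝓘(ℝ, E) 𝓘(ℝ, E) e (e.symm q) (X (e.symm q)) := by
  have hd := mdifferentiable_of_mem_maximalAtlas he
  have h1 := hd.comp_symm_deriv hq
  obtain ⟨v, hv⟩ := (hd.symm.mfderiv hq).surjective (X (e.symm q))
  have hv' : mfderiv 𝓘(ℝ, E) 𝓘(ℝ, E) e.symm q v = X (e.symm q) := hv
  rw [mpullback_apply, ← hv']
  have h2 := DFunLike.congr_fun h1 v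
  refine Eq.trans ?_ h2.symm
  exact (isInvertible_mfderiv_symm he hq).inverse_apply_eq.2 rfl

/-- A canonical vector field `C` of `L` satisfies `[C, L] = -L`. -/
theorem fn01_canonical [FiniteDimensional ℝ E] {n : ℕ} {L : VForm1 E M} {C : VField E M}
    (hC : IsCanonicalField n L C) : fn01 C L = -L := by
  have : CompleteSpace E := FiniteDimensional.complete ℝ E
  have : IsManifold 𝓘(ℝ, E) (minSmoothness ℝ 2) M := by
    rw [minSmoothness_of_isRCLikeNormedField]
    infer_instance
  have : IsManifold 𝓘(ℝ, E) (minSmoothness ℝ 3) M := by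
    rw [minSmoothness_of_isRCLikeNormedField]
    exact IsManifold.of_le (n := ∞) ENat.LEInfty.out
  ext Y z
  obtain ⟨e, he, hz, φ, hφ⟩ := hC z
  -- Through `φ`, `A` is `(x,y) ↦ (0,y)`, the expression of `C`, and `B` is `(x,y) ↦ (0,x)`, that of
  -- `L`; hence `AB = B` and `BA = 0`.
  let A : E →L[ℝ] E := φ.symm.toContinuousLinearMap ∘L
    (ContinuousLinearMap.inr ℝ _ _ ∘L ContinuousLinearMap.snd ℝ _ _) ∘L φ.toContinuousLinearMap
  let B : E →L[ℝ] E := φ.symm.toContinuousLinearMap ∘L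
    (ContinuousLinearMap.inr ℝ _ _ ∘L ContinuousLinearMap.fst ℝ _ _) ∘L φ.toContinuousLinearMap
  let pb (X : VField E M) : E → E := mpullback 𝓘(ℝ, E) 𝓘(ℝ, E) e.symm X
  have hL (X : VField E M) {q : E} (hq : q ∈ e.target) : pb (L X) q = B (pb X q) := by
    refine φ.injective ?_
    have h1 : pb (L X) q = mfderiv 𝓘(ℝ, E) 𝓘(ℝ, E) e (e.symm q) (L X (e.symm q)) :=
      mpullback_symm_apply he (L X) hq
    have h2 : pb X q = mfderiv 𝓘(ℝ, E) 𝓘(ℝ, E) e (e.symm q) (X (e.symm q)) :=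
      mpullback_symm_apply he X hq
    rw [h1, h2]
    refine ((hφ _ (e.map_target hq)).1 X).trans ?_
    exact (φ.apply_symm_apply _).symm
  have hA {q : E} (hq : q ∈ e.target) : pb C q = A q := by
    refine φ.injective ?_
    have h1 : pb C q = mfderiv 𝓘(ℝ, E) 𝓘(ℝ, E) e (e.symm q) (C (e.symm q)) :=
      mpullback_symm_apply he C hq
    rw [h1]
    refine (hφ _ (e.map_target hq)).2.trans ?_
    simp [A, e.right_inv hq]
  have hp : e z ∈ e.target := e.map_source hz
  have hs : ContMDiffAt 𝓘(ℝ, E) 𝓘(ℝ, E) ∞ e.symm (e z) :=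
    contMDiffAt_symm_of_mem_maximalAtlas he hp
  have hn : e.target ∈ 𝓝 (e z) := e.open_target.mem_nhds hp
  -- Naturality of the Lie bracket under pullback moves the computation to the vector space `E`.
  have hbr (X X' : VField E M) : pb ⁅X, X'⁆ (e z) = lieBracket ℝ (pb X) (pb X') (e z) := by
    have h := mpullback_mlieBracket (I := 𝓘(ℝ, E)) (X.mdifferentiableAt (x := e.symm (e z)))
      (X'.mdifferentiableAt (x := e.symm (e z))) hs
      (by rw [minSmoothness_of_isRCLikeNormedField]; exact ENat.LEInfty.out)
    rw [← mlieBracketWithin_univ (I := 𝓘(ℝ, E)) (M := E), mlieBracketWithin_eq_lieBracketWithin] at h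
    have hu : lieBracketWithin ℝ (pb X) (pb X') Set.univ = lieBracket ℝ (pb X) (pb X') :=
      lieBracketWithin_univ
    exact h.trans (congrFun hu _)
  have hY : DifferentiableAt ℝ (pb Y) (e z) := by
    have h := ((Y.contMDiff (e.symm (e z))).of_le (m := 1)
      ENat.LEInfty.out).mpullback_vectorField_preimage hs (isInvertible_mfderiv_symm he hp)
      (by rw [one_add_one_eq_two]; exact ENat.LEInfty.out)
    exact (contMDiffAt_vectorSpace_iff_contDiffAt.1 h).differentiableAt one_ne_zero
  have key := lieBracket_clm_comp (A := A) (B := B) (by intro v; simp [A, B])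
    (by intro v; simp [A, B]) hY
  -- The bracket differentiates its arguments, so the coordinate expressions must agree near `e z`,
  -- not just at it.
  have hAe : pb C =ᶠ[𝓝 (e z)] A := by
    filter_upwards [hn] with q hq using hA hq
  have hLe : pb (L Y) =ᶠ[𝓝 (e z)] fun q => B (pb Y q) := by
    filter_upwards [hn] with q hq using hL Y hq
  have e1 : pb (fn01 C L Y) (e z) = pb ((-L) Y) (e z) := by
    have h1 : pb (fn01 C L Y) (e z) = pb ⁅C, L Y⁆ (e z) - pb (L ⁅C, Y⁆) (e z) :=
      map_sub (mfderiv 𝓘(ℝ, E) 𝓘(ℝ, E) e.symm (e z)).inverse _ _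
    have h2 : pb ((-L) Y) (e z) = -pb (L Y) (e z) :=
      map_neg (mfderiv 𝓘(ℝ, E) 𝓘(ℝ, E) e.symm (e z)).inverse _
    rw [h1, h2, hL _ hp, hL _ hp, hbr, hbr, hAe.lieBracket_vectorField_eq hLe,
      hAe.lieBracket_vectorField_eq EventuallyEq.rfl, key]
  have hinj : Function.Injective (mfderiv 𝓘(ℝ, E) 𝓘(ℝ, E) e.symm (e z)).inverse := by
    obtain ⟨ψ, hψ⟩ := isInvertible_mfderiv_symm he hp
    rw [← hψ, ContinuousLinearMap.inverse_equiv]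
    exact ψ.symm.injective
  have := hinj e1
  rwa [e.left_inv hz] at this

end Coordinates
end LConn

theorem theorem5 {E M : Type*} [NormedAddCommGroup E] [NormedSpace ℝ E] [FiniteDimensional ℝ E]
    [TopologicalSpace M] [T2Space M] [ParacompactSpace M] [ChartedSpace E M]
    [IsManifold 𝓘(ℝ, E) ∞ M]
    (n : ℕ) (L : VForm1 E M) (hL : IsLStructure n L)
    (Γ : VForm1 E M) (hΓ : IsLConnection L Γ) :
    fn12 L (curvature Γ) = fn12 (horProj Γ) (torsion L Γ) ∧
    fn12 (horProj Γ) (curvature Γ) = 0 ∧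
    ∀ C : VField E M, IsCanonicalField n L C →
      ∀ S S' : VField E M, IsCanonicalSemispray L C Γ S → IsSemispray L C S' →
        fn12 (fn10 L S) (curvature Γ) = -fn12 (strongTorsion L C Γ S') (curvature Γ) := by
  refine ⟨fn12_curvature L Γ, fn12_horProj_curvature Γ, fun C hC S S' hS hS' => ?_⟩
  exact fn12_fn10_curvature hL hΓ (fn01_canonical hC) hS hS'
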